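/- **Theorem (warehouse approximation of the optimal cost).** Let $X$ be a locally compact Polish space with a complete metric $d$ and its Borel $\sigma$-algebra. Let $\lambda,\rho$ be finite positive Borel measures on $X$ with compact supports and $\|\lambda\|:=\lambda(X)=\rho(X)$. Let $c:X\times X\to[0,\infty)$ be continuous with $c(x,y)\le\alpha\, d(x,y)^p$ for all $x,y$, where $\alpha,p>0$ are constants. *Definitions.* Let $\mathcal M$ be the space of finite signed Borel measures on $X$ with the total variation norm. For $\Phi:\mathcal M\to\mathcal M$: - $\Phi$ is *Markov* if it is linear, continuous for the total variation norm, positive ($\sigma\ge0\Rightarrow\Phi\sigma\ge0$) and satisfies $(\Phi\sigma)(X)=\sigma(X)$ for all $\sigma\in\mathcal M$. - $\Phi$ is *simple* if $\Phi\sigma=\sum_{i=1}^m\bigl(\int f_i\,d\sigma\bigr)\rho_i$ for all $\sigma\in\mathcal M$, for some finite family of bounded continuous $f_i:X\to\mathbb R$ and $\rho_i\in\mathcal M$. - For finite positive $\mu,\nu$ of equal mass, $\Pi(\mu,\nu)$ is the set of positive measures on $X\times X$ with marginals $\mu,\nu$, and $C(\mu,\nu):=\inf_{\kappa\in\Pi(\mu,\nu)}\int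 c\,d\kappa$ is the optimal cost. - The plan corresponding to $\Phi$ and $\mu$ is the (unique) finite positive measure $\kappa$ on $X\times X$ with $\kappa(A\times B)=\Phi(1_A\mu)(B)$ for all Borel $A,B$. The cost of $\Phi$ on $\mu$ is $c(\Phi,\mu):=\int c\,d\kappa$. $\Phi$ is *$c$-optimal on $\mu$* if $\kappa$ minimizes $\int c\,d\pi$ over all $\pi$ with the same marginals as $\kappa$, and *$\delta$-local on $\mu$* if $\kappa\{(x,y):d(x,y)>\delta\}=0$. - A *warehouse strategy of scale $\delta>0$* consists of finitely many points $x_1,\dots,x_n\in X$, weights $a_i,b_i\ge0$ and simple Markov maps $\Phi_1,\Phi_2,\Phi_3$ such that, with $\lambda'=\sum_i a_i\delta_{x_i}$ and $\rho'=\sum_i b_i\delta_{x_i}$: $\Phi_1\lambda=\lambda'$ and $\Phi_1$ is $\delta$-local on $\lambda$ (local collection); $\Phi_2\lambda'=\rho'$ and $\Phi_2$ is $c$-optimal on $\lambda'$ (discrete transport problem); $\Phi_3\rho'=\rho$ and $\Phi_3$ is $\delta$-local on $\rho'$ (local redistribution). Put $\Phi=\Phi_3\circ\Phi_2\circ\Phi_1$.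 *Claim.* 1. $C(\lambda,\rho)<\infty$, and for every $\varepsilon>0$ there is a simple Markov $\Phi$ with $\Phi\lambda=\rho$ and $C(\lambda,\rho)\le c(\Phi,\lambda)\le C(\lambda,\rho)+\varepsilon$. 2. For every $\delta>0$ there is a warehouse strategy of scale $\delta$. For every such strategy, $c(\Phi_1,\lambda)\le\alpha\delta^p\|\lambda\|$ and $c(\Phi_3,\rho')\le\alpha\delta^p\|\lambda\|$. 3. For every $\varepsilon>0$ there is $\delta_0>0$ such that for every $\delta\in(0,\delta_0]$ and every warehouse strategy of scale $\delta$: the composition $\Phi$ is a simple Markov map with $\Phi\lambda=\rho$ and $C(\lambda,\rho)\le c(\Phi,\lambda)\le C(\lambda,\rho)+\varepsilon$; moreover $|c(\Phi_2,\lambda')-C(\lambda,\rho)|\le\varepsilon$ and $|c(\Phi_1,\lambda)+c(\Phi_2,\lambda')+c(\Phi_3,\rho')-C(\lambda,\rho)|\le\varepsilon$. -/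

import Mathlib

open MeasureTheory Set
open scoped NNReal ENNReal BoundedContinuousFunction

noncomputable section

namespace Transport

variable {X Y : Type*} [MeasurableSpace X] [MeasurableSpace Y]

/-- A transfunction: any map between the spaces of finite signed measures. -/
abbrev Transfunction (X Y : Type*) [MeasurableSpace X] [MeasurableSpace Y] : Type _ :=
  SignedMeasure X → SignedMeasure Y

/-- The total variation norm of a finite signed measure. -/
def tvNorm (s : SignedMeasure X) : ℝ := s.totalVariation.real univ

/-- Strong σ-additivity: linearity together with continuity for the total variation norm. -/
structure IsStronglySigmaAdditive (Φ : Transfunction X Y) : Prop where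
  linear : IsLinearMap ℝ Φ
  continuous : ∀ s : SignedMeasure X, ∀ ε : ℝ, 0 < ε → ∃ δ : ℝ, 0 < δ ∧
    ∀ t : SignedMeasure X, tvNorm (t - s) < δ → tvNorm (Φ t - Φ s) < ε

/-- Markov transfunctions: strongly σ-additive, positive and measure-preserving. -/
structure IsMarkov (Φ : Transfunction X Y) : Prop where
  stronglySigmaAdditive : IsStronglySigmaAdditive Φ
  positive : ∀ s : SignedMeasure X, 0 ≤ s → 0 ≤ Φ s
  measurePreserving : ∀ s : SignedMeasure X, Φ s univ = s univ

/-- Simple transfunctions `s ↦ ∑ i, ⟨f i, s⟩ • ρ i` (finite sum) with bounded continuous real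
functions `f i` and finite signed measures `ρ i`. -/
def IsSimple [TopologicalSpace X] (Φ : Transfunction X Y) : Prop :=
  ∃ (m : ℕ) (f : Fin m → (X →ᵇ ℝ)) (ρ : Fin m → SignedMeasure Y),
    ∀ s : SignedMeasure X, Φ s = ∑ i, (∫ᵛ x, f i x ∂<•s) • ρ i

/-- `κ` is a plan with marginals `μ` and `ν`. -/
def IsPlan (μ : Measure X) (ν : Measure Y) (κ : Measure (X × Y)) : Prop :=
  (∀ A, MeasurableSet A → κ (A ×ˢ univ) = μ A) ∧ (∀ B, MeasurableSet B → κ (univ ×ˢ B) = ν B)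

/-- `κ` is the plan that corresponds to the transfunction `Φ` and the input `μ`:
`κ (A × B) = Φ (1_A μ) (B)`. It is unique, see `Corresponds.unique`. -/
structure Corresponds (Φ : Transfunction X Y) (μ : Measure X) [IsFiniteMeasure μ]
    (κ : Measure (X × Y)) : Prop where
  finite : IsFiniteMeasure κ
  apply_prod : ∀ A B, MeasurableSet A → MeasurableSet B →
    κ.real (A ×ˢ B) = Φ (μ.restrict A).toSignedMeasure B

theorem Corresponds.unique {Φ : Transfunction X Y} {μ : Measure X} [IsFiniteMeasure μ]
    {κ κ' : Measure (X × Y)} (h : Corresponds Φ μ κ) (h' : Corresponds Φ μ κ') : κ = κ' := by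
  have := h.finite
  have := h'.finite
  refine Measure.ext_prod fun {A B} hA hB => ?_
  have e : κ.real (A ×ˢ B) = κ'.real (A ×ˢ B) := by
    rw [h.apply_prod A B hA hB, h'.apply_prod A B hA hB]
  exact (measureReal_eq_measureReal_iff).1 e

/-- The cost `∫ c dκ` of a plan. -/
def planCost (c : X × Y → ℝ≥0) (κ : Measure (X × Y)) : ℝ≥0∞ := ∫⁻ z, c z ∂κ

/-- The optimal transport cost between `μ` and `ν`. -/
def optimalCost (c : X × Y → ℝ≥0) (μ : Measure X) (ν : Measure Y) : ℝ≥0∞ :=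
  ⨅ (κ : Measure (X × Y)) (_ : IsPlan μ ν κ), planCost c κ

/-- `κ` is a `c`-optimal plan between `μ` and `ν`. -/
def IsOptimalPlan (c : X × Y → ℝ≥0) (μ : Measure X) (ν : Measure Y) (κ : Measure (X × Y)) :
    Prop :=
  IsPlan μ ν κ ∧ ∀ π : Measure (X × Y), IsPlan μ ν π → planCost c κ ≤ planCost c π

/-- The cost of the transfunction `Φ` on the input `μ`: the cost of the plan that corresponds to
`Φ` and `μ` (and `∞` if there is none); see `Corresponds.transfunctionCost_eq`. -/
def transfunctionCost (c : X × Y → ℝ≥0) (Φ : Transfunction X Y) (μ : Measure X)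
    [IsFiniteMeasure μ] : ℝ≥0∞ :=
  ⨅ (κ : Measure (X × Y)) (_ : Corresponds Φ μ κ), planCost c κ

theorem Corresponds.transfunctionCost_eq {Φ : Transfunction X Y} {μ : Measure X}
    [IsFiniteMeasure μ] {κ : Measure (X × Y)} (h : Corresponds Φ μ κ) (c : X × Y → ℝ≥0) :
    transfunctionCost c Φ μ = planCost c κ :=
  le_antisymm (iInf₂_le κ h) (le_iInf₂ fun _ h' => by rw [h.unique h'])

/-- `Φ` is `c`-optimal on `μ`: the corresponding plan, whose marginals are `μ` and `Φ μ`,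
is `c`-optimal. -/
def IsOptimalOn (c : X × Y → ℝ≥0) (Φ : Transfunction X Y) (μ : Measure X)
    [IsFiniteMeasure μ] : Prop :=
  ∃ κ : Measure (X × Y), Corresponds Φ μ κ ∧ IsOptimalPlan c μ κ.snd κ

/-- On the input `μ`, the transfunction `Φ` moves no mass farther than `δ`. -/
def IsLocalOn [Dist X] (δ : ℝ) (Φ : Transfunction X X) (μ : Measure X)
    [IsFiniteMeasure μ] : Prop :=
  ∃ κ : Measure (X × X), Corresponds Φ μ κ ∧ κ {z | δ < dist z.1 z.2} = 0

/-- The positive simple measure with mass `w i` at the point `x i`. -/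
def pointMasses {n : ℕ} (x : Fin n → X) (w : Fin n → ℝ≥0) : Measure X :=
  ∑ i, w i • Measure.dirac (x i)

instance {n : ℕ} (x : Fin n → X) (w : Fin n → ℝ≥0) : IsFiniteMeasure (pointMasses x w) := by
  unfold pointMasses; infer_instance

/-- A warehouse strategy at scale `δ` from `lam` to `rho`. There are finitely many warehouses
(points of `X`). The simple Markov transfunction `collect` moves `lam` over distances at most `δ`
to point masses at the warehouses, `transfer` solves the discrete transport problem between
the warehouses optimally, and `distribute` moves the resulting point masses over distances at
most `δ` to form `rho`. -/
structure WarehouseStrategy [MetricSpace X] (c : X × X → ℝ≥0) (lam rho : Measure X)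
    [IsFiniteMeasure lam] [IsFiniteMeasure rho] (δ : ℝ) where
  /-- number of warehouses -/
  n : ℕ
  /-- positions of the warehouses -/
  site : Fin n → X
  /-- mass collected at each warehouse -/
  stock : Fin n → ℝ≥0
  /-- mass needed at each warehouse for the final distribution -/
  demand : Fin n → ℝ≥0
  collect : Transfunction X X
  transfer : Transfunction X X
  distribute : Transfunction X X
  collect_simple : IsSimple collect
  collect_markov : IsMarkov collect
  transfer_simple : IsSimple transfer
  transfer_markov : IsMarkov transfer
  distribute_simple : IsSimple distribute
  distribute_markov : IsMarkov distribute
  collect_apply : collect lam.toSignedMeasure = (pointMasses site stock).toSignedMeasure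
  transfer_apply : transfer (pointMasses site stock).toSignedMeasure =
    (pointMasses site demand).toSignedMeasure
  distribute_apply : distribute (pointMasses site demand).toSignedMeasure = rho.toSignedMeasure
  collect_local : IsLocalOn δ collect lam
  transfer_optimal : IsOptimalOn c transfer (pointMasses site stock)
  distribute_local : IsLocalOn δ distribute (pointMasses site demand)

namespace WarehouseStrategy

variable [MetricSpace X] {c : X × X → ℝ≥0} {lam rho : Measure X}
  [IsFiniteMeasure lam] [IsFiniteMeasure rho] {δ : ℝ}

/-- The composed transfunction of a warehouse strategy. -/
def total (W : WarehouseStrategy c lam rho δ) : Transfunction X X :=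
  W.distribute ∘ W.transfer ∘ W.collect

def collectCost (W : WarehouseStrategy c lam rho δ) : ℝ≥0∞ :=
  transfunctionCost c W.collect lam

def transferCost (W : WarehouseStrategy c lam rho δ) : ℝ≥0∞ :=
  transfunctionCost c W.transfer (pointMasses W.site W.stock)

def distributeCost (W : WarehouseStrategy c lam rho δ) : ℝ≥0∞ :=
  transfunctionCost c W.distribute (pointMasses W.site W.demand)

end WarehouseStrategy

end Transport

end

/-!
A simple Markov transfunction `Φ s = ∑ i, ⟨f i, s⟩ • ρ i` is the action of the Markov kernel
`K x = Φ δₓ` (`exists_isRepresentedBy`), so the plan that corresponds to `Φ` and `μ` is `μ ⊗ₘ K` and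
compositions of transfunctions are compositions of kernels. That `Φ` is `δ`-local on `μ` means that
`μ ⊗ₘ K`-almost all displacements have length at most `δ`; this bounds the cost of the two local
steps by `α δ ^ p` per unit of mass (`transfunctionCost_le_of_isLocalOn`).

Since both supports are compact, `c` is uniformly continuous at their product: for small `δ`, moving
both ends of a path between the supports by at most `δ` changes its cost by at most `η`
(`exists_modulus`). Hence the whole strategy costs at most `η` per unit of mass more than its
transfer step (`lintegral_comp_le`). Conversely, let `π` be any plan between `lam` and `rho`. Moving
its first marginal by the collection kernel and its second marginal by the posterior of the
redistribution kernel gives a plan between the point masses, which costs at most `η` per unit of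
mass more than `π` (`exists_isPlan_planCost_le`). The transfer is optimal, so it costs no more than
that plan. As the plan of the whole strategy is itself a plan between `lam` and `rho`, all these costs
agree up to multiples of `η` (`WarehouseStrategy.transferCost_estimates`).

Strategies exist at every scale (`nonempty_warehouseStrategy`): the sites are the centres of
finitely many `δ`-balls that cover both supports, a partition of unity subordinate to these balls
splits `lam` and `rho` into parts near the sites, and the transfer comes from a minimizer over the
compact polytope of transport matrices (`exists_optimal_matrix`). Continuous weights that separate the sites
turn a transport matrix into a simple transfunction (`exists_simple_markov_of_pointMasses`). The
strategy for a small `δ` is the simple Markov transfunction of nearly optimal cost.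
-/

namespace Transport
open ProbabilityTheory

/-! ### Markov transfunctions and plans -/

section General

variable {X Y Z : Type*} [MeasurableSpace X] [MeasurableSpace Y] [MeasurableSpace Z]

theorem exists_toSignedMeasure_eq {s : SignedMeasure X} (hs : 0 ≤ s) :
    ∃ μ : Measure X, ∃ _ : IsFiniteMeasure μ, s = μ.toSignedMeasure :=
  ⟨_, inferInstance, (SignedMeasure.toMeasureOfZeroLE_toSignedMeasure s
    ((VectorMeasure.le_restrict_univ_iff_le _ _).2 hs)).symm⟩

theorem tvNorm_toSignedMeasure_sub_le (μ ν : Measure X) [IsFiniteMeasure μ] [IsFiniteMeasure ν] :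
    tvNorm (μ.toSignedMeasure - ν.toSignedMeasure) ≤ μ.real univ + ν.real univ := by
  rw [tvNorm, ← measureReal_add_apply, SignedMeasure.totalVariation_eq_variation]
  refine ENNReal.toReal_mono (measure_ne_top _ _) ?_
  have := VectorMeasure.variation_sub_le (μ := μ.toSignedMeasure) (ν := ν.toSignedMeasure)
  simp only [Measure.variation_toSignedMeasure] at this
  exact this univ

theorem tvNorm_eq_posPart_add_negPart (s : SignedMeasure X) :
    tvNorm s = s.toJordanDecomposition.posPart.real univ +
      s.toJordanDecomposition.negPart.real univ := by
  rw [tvNorm, SignedMeasure.totalVariation, measureReal_add_apply]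

/-- A positive linear mass-preserving map does not increase the total variation norm, hence it is
continuous: split a signed measure into its Jordan parts, whose masses are preserved. -/
theorem IsMarkov.of_linear {Φ : Transfunction X Y} (hl : IsLinearMap ℝ Φ)
    (hp : ∀ s : SignedMeasure X, 0 ≤ s → 0 ≤ Φ s)
    (hm : ∀ s : SignedMeasure X, Φ s univ = s univ) : IsMarkov Φ where
  stronglySigmaAdditive :=
    { linear := hl
      continuous := by
        -- The total variation norm does not increase.
        have key : ∀ s : SignedMeasure X, tvNorm (Φ s) ≤ tvNorm s := by
          intro s
          have hs : s.toJordanDecomposition.posPart.toSignedMeasure -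
              s.toJordanDecomposition.negPart.toSignedMeasure = s :=
            s.toSignedMeasure_toJordanDecomposition
          obtain ⟨μ, _, hμ⟩ := exists_toSignedMeasure_eq
            (hp _ (Measure.zero_le_toSignedMeasure s.toJordanDecomposition.posPart))
          obtain ⟨ν, _, hν⟩ := exists_toSignedMeasure_eq
            (hp _ (Measure.zero_le_toSignedMeasure s.toJordanDecomposition.negPart))
          have h1 := hm s.toJordanDecomposition.posPart.toSignedMeasure
          have h2 := hm s.toJordanDecomposition.negPart.toSignedMeasure
          rw [hμ] at h1
          rw [hν] at h2
          simp only [Measure.toSignedMeasure_apply_measurable MeasurableSet.univ] at h1 h2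
          calc tvNorm (Φ s) = tvNorm (μ.toSignedMeasure - ν.toSignedMeasure) := by
                rw [← hμ, ← hν, ← hl.map_sub, hs]
            _ ≤ μ.real univ + ν.real univ := tvNorm_toSignedMeasure_sub_le μ ν
            _ = tvNorm s := by rw [h1, h2, tvNorm_eq_posPart_add_negPart]
        intro s ε hε
        refine ⟨ε, hε, fun t ht => ?_⟩
        rw [← hl.map_sub]
        exact (key _).trans_lt ht }
  positive := hp
  measurePreserving := hm

theorem IsMarkov.comp {Ψ : Transfunction Y Z} {Φ : Transfunction X Y} (hΨ : IsMarkov Ψ)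
    (hΦ : IsMarkov Φ) : IsMarkov (Ψ ∘ Φ) :=
  have h₁ := hΦ.stronglySigmaAdditive.linear
  have h₂ := hΨ.stronglySigmaAdditive.linear
  .of_linear
    { map_add := fun s t => by simp only [Function.comp, h₁.map_add, h₂.map_add]
      map_smul := fun r s => by simp only [Function.comp, h₁.map_smul, h₂.map_smul] }
    (fun s hs => hΨ.positive _ (hΦ.positive s hs))
    (fun s => (hΨ.measurePreserving _).trans (hΦ.measurePreserving s))

theorem IsSimple.comp [TopologicalSpace X] {Ψ : Transfunction Y Z} {Φ : Transfunction X Y}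
    (hΨ : IsLinearMap ℝ Ψ) (hΦ : IsSimple Φ) : IsSimple (Ψ ∘ Φ) := by
  obtain ⟨m, f, ρ, h⟩ := hΦ
  refine ⟨m, f, fun i => Ψ (ρ i), fun s => ?_⟩
  have := map_sum (hΨ.mk' Ψ) (fun i => (∫ᵛ x, f i x ∂<•s) • ρ i) Finset.univ
  simp only [IsLinearMap.mk'_apply, hΨ.map_smul] at this
  simp only [Function.comp, h s, this]

theorem Corresponds.isPlan {Φ : Transfunction X Y} (hΦ : IsMarkov Φ) {μ : Measure X}
    [IsFiniteMeasure μ] {ν : Measure Y} [IsFiniteMeasure ν]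
    (hν : Φ μ.toSignedMeasure = ν.toSignedMeasure) {κ : Measure (X × Y)}
    (h : Corresponds Φ μ κ) : IsPlan μ ν κ := by
  have := h.finite
  constructor
  · intro A hA
    have := h.apply_prod A univ hA MeasurableSet.univ
    rw [hΦ.measurePreserving, Measure.toSignedMeasure_apply_measurable MeasurableSet.univ] at this
    simpa using (measureReal_eq_measureReal_iff).1 this
  · intro B hB
    have := h.apply_prod univ B MeasurableSet.univ hB
    simp only [Measure.restrict_univ, hν] at this
    rw [Measure.toSignedMeasure_apply_measurable hB] at this
    exact (measureReal_eq_measureReal_iff).1 this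

theorem Corresponds.apply_eq {Φ : Transfunction X Y} {μ : Measure X} [IsFiniteMeasure μ]
    {κ : Measure (X × Y)} [IsFiniteMeasure κ] (h : Corresponds Φ μ κ) :
    Φ μ.toSignedMeasure = κ.snd.toSignedMeasure := by
  ext B hB
  have := h.apply_prod univ B MeasurableSet.univ hB
  simp only [Measure.restrict_univ] at this
  rw [← this, Measure.toSignedMeasure_apply_measurable hB, measureReal_def, measureReal_def,
    Measure.snd_apply hB, univ_prod]

theorem optimalCost_le_transfunctionCost {Φ : Transfunction X Y} (hΦ : IsMarkov Φ)
    {μ : Measure X} [IsFiniteMeasure μ] {ν : Measure Y} [IsFiniteMeasure ν]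
    (hν : Φ μ.toSignedMeasure = ν.toSignedMeasure) (c : X × Y → ℝ≥0) :
    optimalCost c μ ν ≤ transfunctionCost c Φ μ :=
  le_iInf₂ fun κ hκ => iInf₂_le κ (hκ.isPlan hΦ hν)

theorem IsMarkov.measure_univ_eq {Φ : Transfunction X Y} (hΦ : IsMarkov Φ) {μ : Measure X}
    [IsFiniteMeasure μ] {ν : Measure Y} [IsFiniteMeasure ν]
    (hν : Φ μ.toSignedMeasure = ν.toSignedMeasure) : ν univ = μ univ := by
  have := hΦ.measurePreserving μ.toSignedMeasure
  rw [hν] at this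
  simp only [Measure.toSignedMeasure_apply_measurable MeasurableSet.univ] at this
  exact (measureReal_eq_measureReal_iff).1 this

theorem IsPlan.isFiniteMeasure {μ : Measure X} [IsFiniteMeasure μ] {ν : Measure Y}
    {κ : Measure (X × Y)} (h : IsPlan μ ν κ) : IsFiniteMeasure κ :=
  ⟨by rw [← univ_prod_univ, h.1 univ MeasurableSet.univ]; exact measure_lt_top _ _⟩

theorem IsPlan.map_fst {μ : Measure X} {ν : Measure Y} {κ : Measure (X × Y)}
    (h : IsPlan μ ν κ) : κ.map Prod.fst = μ :=
  Measure.ext fun A hA => by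
    rw [Measure.map_apply measurable_fst hA, ← h.1 A hA, Set.prod_univ]

theorem IsPlan.map_snd {μ : Measure X} {ν : Measure Y} {κ : Measure (X × Y)}
    (h : IsPlan μ ν κ) : κ.map Prod.snd = ν :=
  Measure.ext fun A hA => by
    rw [Measure.map_apply measurable_snd hA, ← h.2 A hA, Set.univ_prod]

theorem IsPlan.swap {μ : Measure X} {ν : Measure Y}
    {π : Measure (X × Y)} (h : IsPlan μ ν π) : IsPlan ν μ (π.map Prod.swap) := by
  constructor
  · intro B hB
    rw [Measure.map_apply measurable_swap (hB.prod MeasurableSet.univ),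
      preimage_swap_prod, h.2 B hB]
  · intro A hA
    rw [Measure.map_apply measurable_swap (MeasurableSet.univ.prod hA),
      preimage_swap_prod, h.1 A hA]

end General

/-! ### Transfunctions given by Markov kernels -/

section Kernel

variable {X Y : Type*} [MeasurableSpace X] [MeasurableSpace Y]

/-- `Φ` acts on finite positive measures as the Markov kernel `K`. -/
def IsRepresentedBy (Φ : Transfunction X Y) (K : Kernel X Y) [IsMarkovKernel K] : Prop :=
  ∀ (μ : Measure X) [IsFiniteMeasure μ], Φ μ.toSignedMeasure = (K ∘ₘ μ).toSignedMeasure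

theorem IsRepresentedBy.corresponds {Φ : Transfunction X Y} {K : Kernel X Y} [IsMarkovKernel K]
    (h : IsRepresentedBy Φ K) (μ : Measure X) [IsFiniteMeasure μ] :
    Corresponds Φ μ (μ ⊗ₘ K) where
  finite := inferInstance
  apply_prod A B hA hB := by
    rw [h, Measure.toSignedMeasure_apply_measurable hB, measureReal_def, measureReal_def,
      Measure.compProd_apply_prod hA hB, Measure.bind_apply hB K.aemeasurable]

theorem IsRepresentedBy.bind_eq {Φ : Transfunction X Y} {K : Kernel X Y} [IsMarkovKernel K]
    (h : IsRepresentedBy Φ K) {μ : Measure X} [IsFiniteMeasure μ] {ν : Measure Y}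
    [IsFiniteMeasure ν] (hν : Φ μ.toSignedMeasure = ν.toSignedMeasure) : K ∘ₘ μ = ν := by
  rw [h μ] at hν
  exact (Measure.toSignedMeasure_eq_toSignedMeasure_iff).1 hν

theorem IsRepresentedBy.comp {Z : Type*} [MeasurableSpace Z] {Ψ : Transfunction Y Z}
    {Φ : Transfunction X Y} {L : Kernel Y Z} [IsMarkovKernel L] {K : Kernel X Y}
    [IsMarkovKernel K] (hΨ : IsRepresentedBy Ψ L) (hΦ : IsRepresentedBy Φ K) :
    IsRepresentedBy (Ψ ∘ Φ) (L ∘ₖ K) := by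
  intro μ _
  rw [Function.comp, hΦ μ, hΨ (K ∘ₘ μ)]
  exact Measure.toSignedMeasure_congr Measure.comp_assoc

/-- Simple Markov transfunctions are given by Markov kernels. The kernel sends `x` to the image
`Φ δₓ` of the Dirac measure; it depends measurably on `x` because `Φ δₓ = ∑ i, f i x • ρ i`. -/
theorem exists_isRepresentedBy [TopologicalSpace X] [OpensMeasurableSpace X]
    {Φ : Transfunction X Y} (hs : IsSimple Φ) (hΦ : IsMarkov Φ) :
    ∃ (K : Kernel X Y) (_ : IsMarkovKernel K), IsRepresentedBy Φ K := by
  obtain ⟨m, f, ρ, h⟩ := hs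
  have hdirac : ∀ x B, Φ (Measure.dirac x).toSignedMeasure B = ∑ i, f i x * ρ i B := by
    intro x B
    rw [h, FunLike.coe_sum, Finset.sum_apply]
    refine Finset.sum_congr rfl fun i _ => ?_
    rw [smul_apply, smul_eq_mul, VectorMeasure.integral_toSignedMeasure,
      integral_dirac' _ _ (f i).continuous.measurable.stronglyMeasurable]
  choose k hfin hk using fun x => exists_toSignedMeasure_eq
    (hΦ.positive _ (Measure.zero_le_toSignedMeasure (Measure.dirac x)))
  have hreal : ∀ x B, MeasurableSet B → (k x).real B = ∑ i, f i x * ρ i B := by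
    intro x B hB
    rw [← hdirac, hk, Measure.toSignedMeasure_apply_measurable hB]
  have hmeas : Measurable k := by
    refine Measure.measurable_of_measurable_coe _ fun B hB => ?_
    have : (fun x => k x B) = fun x => ENNReal.ofReal (∑ i, f i x * ρ i B) := by
      funext x
      rw [← hreal x B hB, ofReal_measureReal]
    rw [this]
    exact (Finset.measurable_sum _ fun i _ =>
      (f i).continuous.measurable.mul_const _).ennreal_ofReal
  have hprob : ∀ x, IsProbabilityMeasure (k x) := fun x =>
    ⟨(hΦ.measure_univ_eq (hk x)).trans measure_univ⟩
  let K : Kernel X Y := ⟨k, hmeas⟩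
  have hK : IsMarkovKernel K := ⟨hprob⟩
  refine ⟨K, hK, fun μ _ => ?_⟩
  ext B hB
  have hint : ∀ i, Integrable (fun x => f i x * ρ i B) μ := fun i =>
    ((f i).integrable μ).mul_const _
  rw [Measure.toSignedMeasure_apply_measurable hB, measureReal_def,
    Measure.bind_apply hB K.aemeasurable, h, FunLike.coe_sum, Finset.sum_apply]
  simp only [smul_apply, smul_eq_mul, VectorMeasure.integral_toSignedMeasure,
    ← integral_mul_const]
  rw [← integral_finsetSum _ fun i _ => hint i]
  simp only [← hreal _ B hB]
  exact integral_toReal ((Measure.measurable_coe hB).comp hmeas).aemeasurable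
    (.of_forall fun x => measure_lt_top _ _)

end Kernel

/-! ### Simple Markov transfunctions from partitions of unity -/

section Mixture

variable {X Y : Type*} [MeasurableSpace X] [MeasurableSpace Y] [TopologicalSpace X]
  {ι : Type*} [Fintype ι]

/-- The simple transfunction that splits its input with the weight functions `f i` and replaces
the `i`-th part by a multiple of `ν i`. It is Markov if the weights are nonnegative with sum `1` and
the `ν i` are probability measures; any finite index type is allowed, in view of `Option`. -/
noncomputable def mixture (f : ι → X →ᵇ ℝ) (ν : ι → Measure Y) [∀ i, IsFiniteMeasure (ν i)] :
    Transfunction X Y :=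
  fun s => ∑ i, (∫ᵛ x, f i x ∂<•s) • (ν i).toSignedMeasure

instance (s : SignedMeasure X) : IsFiniteMeasure s.variation := by
  rw [← SignedMeasure.totalVariation_eq_variation]
  infer_instance

theorem mixture_isSimple (f : ι → X →ᵇ ℝ) (ν : ι → Measure Y) [∀ i, IsFiniteMeasure (ν i)] :
    IsSimple (mixture f ν) :=
  let e := Fintype.equivFin ι
  ⟨Fintype.card ι, fun j => f (e.symm j), fun j => (ν (e.symm j)).toSignedMeasure, fun s =>
    (e.symm.sum_comp fun i => (∫ᵛ x, f i x ∂<•s) • (ν i).toSignedMeasure).symm⟩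

variable [BorelSpace X]

theorem integrable_boundedContinuousFunction (s : SignedMeasure X) (f : X →ᵇ ℝ) :
    s.Integrable f :=
  f.integrable s.variation

variable {f : ι → X →ᵇ ℝ} {ν : ι → Measure Y} [∀ i, IsProbabilityMeasure (ν i)]

theorem mixture_isMarkov (hf : ∀ i x, 0 ≤ f i x) (hsum : ∀ x, ∑ i, f i x = 1) :
    IsMarkov (mixture f ν) := by
  refine .of_linear ⟨fun s t => ?_, fun r s => ?_⟩ (fun s hs => ?_) fun s => ?_
  · simp only [mixture]
    rw [← Finset.sum_add_distrib]
    refine Finset.sum_congr rfl fun i _ => ?_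
    rw [VectorMeasure.integral_add_vectorMeasure (integrable_boundedContinuousFunction s (f i))
      (integrable_boundedContinuousFunction t (f i)), add_smul]
  · simp only [mixture]
    rw [Finset.smul_sum]
    refine Finset.sum_congr rfl fun i _ => ?_
    rw [VectorMeasure.integral_smul_vectorMeasure, smul_smul, smul_eq_mul]
  · obtain ⟨μ, _, rfl⟩ := exists_toSignedMeasure_eq hs
    intro A hA
    simp only [mixture, FunLike.coe_sum, Finset.sum_apply, smul_apply, smul_eq_mul,
      VectorMeasure.integral_toSignedMeasure, Measure.toSignedMeasure_apply_measurable hA]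
    exact Finset.sum_nonneg fun i _ => mul_nonneg (integral_nonneg (hf i)) measureReal_nonneg
  · simp only [mixture, FunLike.coe_sum, Finset.sum_apply, smul_apply, smul_eq_mul,
      Measure.toSignedMeasure_apply_measurable MeasurableSet.univ, probReal_univ, mul_one]
    rw [← VectorMeasure.integral_finsetSum _ fun i _ =>
      integrable_boundedContinuousFunction s (f i)]
    simp only [hsum]
    rw [VectorMeasure.integral_const]
    simp

theorem withDensity_real_apply {μ : Measure X} [IsFiniteMeasure μ] {g : X →ᵇ ℝ}
    (hg : ∀ x, 0 ≤ g x) {A : Set X} (hA : MeasurableSet A) :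
    (μ.withDensity fun x => ENNReal.ofReal (g x)).real A = ∫ x in A, g x ∂μ := by
  rw [measureReal_def, withDensity_apply _ hA, integral_eq_lintegral_of_nonneg_ae (.of_forall hg)
    g.continuous.aestronglyMeasurable]

instance (μ : Measure X) [IsFiniteMeasure μ] (g : X →ᵇ ℝ) :
    IsFiniteMeasure (μ.withDensity fun x => ENNReal.ofReal (g x)) :=
  isFiniteMeasure_withDensity_ofReal (g.integrable μ).2

/-- The plan of a mixture spreads the `i`-th part `f i • μ` of the input independently over
`ν i`. -/
theorem mixture_corresponds (hf : ∀ i x, 0 ≤ f i x) (μ : Measure X) [IsFiniteMeasure μ] :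
    Corresponds (mixture f ν) μ
      (∑ i, (μ.withDensity fun x => ENNReal.ofReal (f i x)).prod (ν i)) where
  finite := inferInstance
  apply_prod A B hA hB := by
    simp only [mixture, FunLike.coe_sum, Finset.sum_apply, smul_apply, smul_eq_mul,
      VectorMeasure.integral_toSignedMeasure, Measure.toSignedMeasure_apply_measurable hB]
    rw [measureReal_def, Measure.finsetSum_apply, ENNReal.toReal_sum fun i _ => measure_ne_top _ _]
    refine Finset.sum_congr rfl fun i _ => ?_
    rw [Measure.prod_prod, ENNReal.toReal_mul, ← measureReal_def, ← measureReal_def,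
      withDensity_real_apply (hf i) hA]

end Mixture

/-- A partition of unity on the whole space for an open cover of a closed set `s`; the additional
index `none` carries the weight that is left over outside `s`. -/
theorem exists_partition {X ι : Type*} [TopologicalSpace X] [NormalSpace X] [Fintype ι]
    {s : Set X} (hs : IsClosed s) {U : ι → Set X} (hU : ∀ i, IsOpen (U i))
    (hsU : s ⊆ ⋃ i, U i) :
    ∃ f : Option ι → X →ᵇ ℝ, (∀ i x, 0 ≤ f i x) ∧ (∀ x, ∑ i, f i x = 1) ∧
      (∀ x ∈ s, f none x = 0) ∧ ∀ i x, x ∉ U i → f (some i) x = 0 := by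
  -- Together with `sᶜ`, the sets `U i` cover the whole space.
  obtain ⟨f, hf⟩ := PartitionOfUnity.exists_isSubordinate_of_locallyFinite isClosed_univ
    (fun i : Option ι => i.elim sᶜ U) (by rintro (_ | i); exacts [hs.isOpen_compl, hU i])
    (locallyFinite_of_finite _) (by
      intro x _
      by_cases hx : x ∈ s
      · obtain ⟨i, hi⟩ := mem_iUnion.1 (hsU hx)
        exact mem_iUnion.2 ⟨some i, hi⟩
      · exact mem_iUnion.2 ⟨none, hx⟩)
  have hsupp : ∀ i x, x ∉ i.elim sᶜ U → f i x = 0 := fun i x hx => by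
    by_contra h
    exact hx (hf i (subset_tsupport _ h))
  refine ⟨fun i => BoundedContinuousFunction.mkOfBound (f i) 1 fun x y => ?_, fun i x =>
    f.nonneg i x, fun x => ?_, fun x hx => hsupp none x (by simpa using hx), fun i x hx =>
    hsupp (some i) x hx⟩
  · rw [Real.dist_eq, abs_le]
    constructor <;> linarith [f.nonneg i x, f.nonneg i y, f.le_one i x, f.le_one i y]
  · exact (finsum_eq_sum_of_fintype fun i => f i x).symm.trans (f.sum_eq_one (mem_univ x))

/-! ### Transfunctions of point masses -/

theorem exists_isProbabilityMeasure_smul {Y : Type*} [MeasurableSpace Y] [Nonempty Y]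
    (m : Measure Y) [IsFiniteMeasure m] :
    ∃ ν : Measure Y, IsProbabilityMeasure ν ∧ m = m univ • ν := by
  refine ⟨FiniteMeasure.normalize ⟨m, inferInstance⟩, inferInstance, ?_⟩
  have := congrArg (fun ν : FiniteMeasure Y => (ν : Measure Y))
    (FiniteMeasure.self_eq_mass_smul_normalize ⟨m, inferInstance⟩)
  rw [FiniteMeasure.toMeasure_smul, FiniteMeasure.toMeasure_mk] at this
  refine this.trans (Measure.ext fun A _ => ?_)
  simp [FiniteMeasure.mass, ENNReal.smul_def]

section PointMasses

variable {X : Type*} [MeasurableSpace X] [MeasurableSingletonClass X] {n : ℕ}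

theorem lintegral_pointMasses (x : Fin n → X) (w : Fin n → ℝ≥0) (g : X → ℝ≥0∞) :
    ∫⁻ z, g z ∂(pointMasses x w) = ∑ i, w i * g (x i) := by
  simp only [pointMasses, lintegral_finsetSum_measure, lintegral_smul_measure, lintegral_dirac]
  rfl

theorem pointMasses_apply (x : Fin n → X) (w : Fin n → ℝ≥0) (A : Set X) (hA : MeasurableSet A) :
    pointMasses x w A = ∑ i, (w i : ℝ≥0∞) * A.indicator 1 (x i) := by
  rw [← lintegral_indicator_one hA, lintegral_pointMasses]

theorem withDensity_pointMasses {x : Fin n → X} (w : Fin n → ℝ≥0) {g : X → ℝ≥0∞} {i : Fin n}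
    (hi : g (x i) = 1) (hne : ∀ j, j ≠ i → g (x j) = 0) :
    (pointMasses x w).withDensity g = w i • Measure.dirac (x i) := by
  ext A hA
  rw [withDensity_apply _ hA, ← lintegral_indicator hA, lintegral_pointMasses,
    Finset.sum_eq_single i]
  · by_cases h : x i ∈ A <;> simp [h, hi]
  · intro j _ hj
    by_cases h : x j ∈ A <;> simp [h, hne j hj]
  · simp

end PointMasses

/-- Point masses at distinct sites can be transformed independently of each other by one simple
Markov transfunction: weights with `f i (site j) = 1` if `i = j` and `0` otherwise tell the sites
apart. They come from the cover of the finite set of sites by the sets that omit all sites but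
one. -/
theorem exists_simple_markov_of_pointMasses {X Y : Type*} [TopologicalSpace X] [NormalSpace X]
    [T1Space X] [MeasurableSpace X] [BorelSpace X] [MeasurableSpace Y] [Nonempty Y] {n : ℕ}
    {site : Fin n → X} (hsite : Function.Injective site) {w : Fin n → ℝ≥0}
    {m : Fin n → Measure Y} [∀ i, IsFiniteMeasure (m i)] (hm : ∀ i, m i univ = w i) :
    ∃ Φ : Transfunction X Y, IsSimple Φ ∧ IsMarkov Φ ∧
      Corresponds Φ (pointMasses site w) (∑ i, (Measure.dirac (site i)).prod (m i)) ∧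
      Φ (pointMasses site w).toSignedMeasure = (∑ i, m i).toSignedMeasure := by
  -- `m i = w i • ν i` with a probability measure `ν i`, also where `w i = 0`.
  choose ν hν hmν using fun i => exists_isProbabilityMeasure_smul (m i)
  obtain ⟨f, hf0, hf1, hfn, hfU⟩ := exists_partition (s := range site)
    (finite_range site).isClosed (U := fun i => (site '' {i}ᶜ)ᶜ)
    (fun i => ((toFinite _).image site).isClosed.isOpen_compl) (by
      rintro _ ⟨i, rfl⟩
      refine mem_iUnion.2 ⟨i, ?_⟩
      rintro ⟨j, hj, hji⟩
      exact hj (hsite hji))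
  have hne : ∀ i j, j ≠ i → f (some i) (site j) = 0 := fun i j hj =>
    hfU i _ fun h => h ⟨j, hj, rfl⟩
  have hone : ∀ i, f (some i) (site i) = 1 := fun i => by
    have := hf1 (site i)
    rwa [Fintype.sum_option, hfn _ (mem_range_self i), zero_add,
      Finset.sum_eq_single i (fun j _ hj => hne j i hj.symm) (by simp)] at this
  let y₀ : Y := Classical.arbitrary Y
  let N : Option (Fin n) → Measure Y := fun o => o.elim (Measure.dirac y₀) ν
  have hN : ∀ o, IsProbabilityMeasure (N o) := by
    rintro (_ | i)
    exacts [inferInstanceAs (IsProbabilityMeasure (Measure.dirac y₀)), hν i]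
  have hcorr := mixture_corresponds (ν := N) hf0 (pointMasses site w)
  have hκ : ∑ o, ((pointMasses site w).withDensity fun x => ENNReal.ofReal (f o x)).prod (N o) =
      ∑ i, (Measure.dirac (site i)).prod (m i) := by
    have hnone : (pointMasses site w).withDensity (fun x => ENNReal.ofReal (f none x)) = 0 := by
      rw [← Measure.measure_univ_eq_zero, withDensity_apply _ MeasurableSet.univ,
        Measure.restrict_univ, lintegral_pointMasses]
      simp [hfn]
    rw [Fintype.sum_option, hnone, Measure.zero_prod, zero_add]
    refine Finset.sum_congr rfl fun i _ => ?_
    rw [withDensity_pointMasses w (i := i) (by simp [hone]) (fun j hj => by simp [hne i j hj])]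
    conv_rhs => rw [hmν i, hm i, Measure.prod_smul_right]
    exact Measure.prod_smul_left _
  rw [hκ] at hcorr
  refine ⟨mixture f N, mixture_isSimple f N, mixture_isMarkov hf0 hf1, hcorr, ?_⟩
  rw [hcorr.apply_eq]
  refine Measure.toSignedMeasure_congr (Measure.ext fun B hB => ?_)
  rw [Measure.snd_apply hB, ← univ_prod]
  simp [Measure.finsetSum_apply]

section Partition

variable {X ι : Type*} [TopologicalSpace X] [MeasurableSpace X] [Fintype ι]
  {f : Option ι → X →ᵇ ℝ}

theorem withDensity_eq_zero_of_ae {μ : Measure X} {s : Set X} (hμ : ∀ᵐ x ∂μ, x ∈ s) {g : X →ᵇ ℝ}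
    (hg : ∀ x ∈ s, g x = 0) : μ.withDensity (fun x => ENNReal.ofReal (g x)) = 0 := by
  rw [withDensity_congr_ae (g := 0) (hμ.mono fun x hx => by simp [hg x hx]), withDensity_zero]

variable [BorelSpace X]

theorem sum_withDensity_eq (hf0 : ∀ i x, 0 ≤ f i x) (hf1 : ∀ x, ∑ i, f i x = 1) {μ : Measure X}
    {s : Set X} (hμ : ∀ᵐ x ∂μ, x ∈ s) (hfn : ∀ x ∈ s, f none x = 0) :
    ∑ i, μ.withDensity (fun x => ENNReal.ofReal (f (some i) x)) = μ := by
  have h : ∑ o, μ.withDensity (fun x => ENNReal.ofReal (f o x)) = μ := by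
    ext A hA
    simp only [Measure.finsetSum_apply, withDensity_apply _ hA]
    rw [← lintegral_finsetSum _ fun o _ => (f o).continuous.measurable.ennreal_ofReal]
    simp [← ENNReal.ofReal_sum_of_nonneg fun o _ => hf0 o _, hf1]
  rwa [Fintype.sum_option, withDensity_eq_zero_of_ae hμ hfn, zero_add] at h

theorem ae_withDensity_mem {μ : Measure X} {g : X →ᵇ ℝ} {U : Set X}
    (hg : ∀ x ∉ U, g x = 0) : ∀ᵐ x ∂μ.withDensity (fun x => ENNReal.ofReal (g x)), x ∈ U := by
  rw [ae_withDensity_iff g.continuous.measurable.ennreal_ofReal]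
  refine .of_forall fun x hx => ?_
  by_contra h
  exact hx (by simp [hg x h])

end Partition

/-! ### The discrete transport problem -/

/-- The discrete transport problem has an optimal solution, since the transport polytope is compact
and, by the product coupling, nonempty. -/
theorem exists_optimal_matrix {ι : Type*} [Fintype ι] (a b : ι → ℝ≥0)
    (hab : ∑ i, a i = ∑ j, b j) (c : ι → ι → ℝ≥0) :
    ∃ M : ι → ι → ℝ≥0, (∀ i, ∑ j, M i j = a i) ∧ (∀ j, ∑ i, M i j = b j) ∧
      ∀ N : ι → ι → ℝ≥0, (∀ i, ∑ j, N i j = a i) → (∀ j, ∑ i, N i j = b j) →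
        ∑ i, ∑ j, M i j * c i j ≤ ∑ i, ∑ j, N i j * c i j := by
  let S : Set (ι → ι → ℝ≥0) := {M | (∀ i, ∑ j, M i j = a i) ∧ ∀ j, ∑ i, M i j = b j}
  have hclosed : IsClosed S := by
    simp only [S, ofPred_and, ofPred_forall]
    exact (isClosed_iInter fun i => isClosed_eq (by fun_prop) continuous_const).inter
      (isClosed_iInter fun j => isClosed_eq (by fun_prop) continuous_const)
  have hcompact : IsCompact S := by
    refine (isCompact_Icc (a := 0) (b := fun i _ => a i)).of_isClosed_subset hclosed fun M hM => ?_
    refine ⟨fun i j => zero_le, fun i j => ?_⟩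
    exact (Finset.single_le_sum (f := fun j => M i j) (fun _ _ => zero_le)
      (Finset.mem_univ j)).trans_eq (hM.1 i)
  have hne : S.Nonempty := by
    refine ⟨fun i j => a i * b j / ∑ k, a k, fun i => ?_, fun j => ?_⟩
    · rw [← Finset.sum_div, ← Finset.mul_sum, ← hab]
      by_cases h : ∑ k, a k = 0
      · simp [h, (Finset.sum_eq_zero_iff.1 h) i]
      · exact mul_div_cancel_right₀ _ h
    · rw [← Finset.sum_div, ← Finset.sum_mul]
      by_cases h : ∑ k, a k = 0
      · simp [h, (Finset.sum_eq_zero_iff.1 (hab ▸ h)) j]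
      · exact mul_div_cancel_left₀ _ h
  obtain ⟨M, hM, hmin⟩ := hcompact.exists_isMinOn hne
    (f := fun M : ι → ι → ℝ≥0 => ∑ i, ∑ j, M i j * c i j) (by fun_prop)
  exact ⟨M, hM.1, hM.2, fun N h₁ h₂ => hmin ⟨h₁, h₂⟩⟩

section Transfer

variable {X : Type*} [MeasurableSpace X] [MeasurableSingletonClass X] {n : ℕ}

theorem pointMasses_singleton {site : Fin n → X} (hsite : Function.Injective site)
    (w : Fin n → ℝ≥0) (i : Fin n) : pointMasses site w {site i} = w i := by
  rw [pointMasses_apply _ _ _ (measurableSet_singleton _), Finset.sum_eq_single i]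
  · simp
  · intro j _ hj
    simp [hsite.ne hj]
  · simp

theorem pointMasses_compl_range (site : Fin n → X) (w : Fin n → ℝ≥0) :
    pointMasses site w (range site)ᶜ = 0 := by
  rw [pointMasses_apply _ _ _ (finite_range site).measurableSet.compl]
  simp

theorem pointMasses_univ (site : Fin n → X) (w : Fin n → ℝ≥0) :
    pointMasses site w univ = ∑ i, (w i : ℝ≥0∞) := by
  rw [pointMasses_apply _ _ _ MeasurableSet.univ]
  simp

theorem IsPlan.sum_singleton_fst {site : Fin n → X} (hsite : Function.Injective site)
    {a b : Fin n → ℝ≥0} {π : Measure (X × X)}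
    (hπ : IsPlan (pointMasses site a) (pointMasses site b) π) (i : Fin n) :
    ∑ j, π {(site i, site j)} = a i := by
  have hnull := hπ.2 _ (finite_range site).measurableSet.compl
  rw [pointMasses_compl_range] at hnull
  rw [← pointMasses_singleton hsite a i, ← hπ.1 _ (measurableSet_singleton _),
    ← tsum_fintype (L := .unconditional _),
    ← measure_iUnion (fun j k hjk => by simp [hsite.ne hjk]) fun _ => measurableSet_singleton _]
  refine le_antisymm (measure_mono ?_) ((measure_mono
    (t := (⋃ j, {(site i, site j)}) ∪ univ ×ˢ (range site)ᶜ) ?_).trans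
      ((measure_union_le _ _).trans (by rw [hnull, add_zero])))
  · exact iUnion_subset fun j => singleton_subset_iff.2 ⟨rfl, mem_univ _⟩
  · rintro ⟨x, y⟩ ⟨rfl, -⟩
    by_cases hy : y ∈ range site
    · obtain ⟨j, rfl⟩ := hy
      exact Or.inl (mem_iUnion.2 ⟨j, rfl⟩)
    · exact Or.inr ⟨mem_univ _, hy⟩

theorem IsPlan.sum_singleton_snd {site : Fin n → X} (hsite : Function.Injective site)
    {a b : Fin n → ℝ≥0} {π : Measure (X × X)}
    (hπ : IsPlan (pointMasses site a) (pointMasses site b) π) (j : Fin n) :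
    ∑ i, π {(site i, site j)} = b j := by
  rw [← hπ.swap.sum_singleton_fst hsite j]
  refine Finset.sum_congr rfl fun i _ => ?_
  rw [Measure.map_apply measurable_swap (measurableSet_singleton _), ← singleton_prod_singleton,
    ← singleton_prod_singleton, preimage_swap_prod]

/-- Only an inequality is claimed, so `π` may have mass outside the finite grid of the sites. -/
theorem sum_le_planCost {site : Fin n → X} (hsite : Function.Injective site) (c : X × X → ℝ≥0)
    (π : Measure (X × X)) :
    ∑ i, ∑ j, π {(site i, site j)} * c (site i, site j) ≤ planCost c π := by
  let z : Fin n × Fin n → X × X := Prod.map site site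
  have hz : Function.Injective z := hsite.prodMap hsite
  calc ∑ i, ∑ j, π {(site i, site j)} * c (site i, site j)
      = ∑ p, π {z p} * c (z p) := (Fintype.sum_prod_type' fun i j =>
        π {(site i, site j)} * (c (site i, site j) : ℝ≥0∞)).symm
    _ = ∫⁻ y in ⋃ p, {z p}, c y ∂π := by
      rw [lintegral_iUnion (fun _ => measurableSet_singleton _)
        (fun p q hpq => by simpa using hz.ne hpq), tsum_fintype]
      simp only [lintegral_singleton, mul_comm]
    _ ≤ planCost c π := setLIntegral_le_lintegral _ _

/-- An optimal matrix `M` of the discrete problem gives the transfunction that replaces the mass at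
`site i` by the point masses `M i`. It is optimal among all plans, since a plan between measures on
the sites is concentrated on pairs of sites. -/
theorem exists_optimal_transfer [TopologicalSpace X] [NormalSpace X] [T1Space X] [BorelSpace X]
    [Nonempty X] {site : Fin n → X} (hsite : Function.Injective site) {a b : Fin n → ℝ≥0}
    (hab : ∑ i, a i = ∑ j, b j) {c : X × X → ℝ≥0} (hc : Measurable c) :
    ∃ Φ : Transfunction X X, IsSimple Φ ∧ IsMarkov Φ ∧
      Φ (pointMasses site a).toSignedMeasure = (pointMasses site b).toSignedMeasure ∧
      IsOptimalOn c Φ (pointMasses site a) := by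
  obtain ⟨M, hMa, hMb, hM⟩ := exists_optimal_matrix a b hab fun i j => c (site i, site j)
  obtain ⟨Φ, hs, hΦ, hcorr, happly⟩ := exists_simple_markov_of_pointMasses hsite (w := a)
    (m := fun i => pointMasses site (M i)) fun i => by
      rw [pointMasses_univ, ← hMa i]; push_cast; rfl
  have hb : ∑ i, pointMasses site (M i) = pointMasses site b := by
    simp only [pointMasses]
    rw [Finset.sum_comm]
    refine Finset.sum_congr rfl fun j _ => ?_
    rw [← Finset.sum_smul, hMb]
  rw [Measure.toSignedMeasure_congr hb] at happly
  refine ⟨Φ, hs, hΦ, happly, _, hcorr, ?_⟩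
  have hsnd : (∑ i, (Measure.dirac (site i)).prod (pointMasses site (M i))).snd =
      pointMasses site b := by
    have := hcorr.apply_eq.symm.trans happly
    exact (Measure.toSignedMeasure_eq_toSignedMeasure_iff).1 this
  rw [hsnd]
  refine ⟨hcorr.isPlan hΦ happly, fun π hπ => ?_⟩
  have := hπ.isFiniteMeasure
  refine le_trans (le_of_eq ?_) (le_trans (ENNReal.coe_le_coe.2
    (hM (fun i j => (π {(site i, site j)}).toNNReal) (fun i => ?_) fun j => ?_))
    (le_trans (le_of_eq ?_) (sum_le_planCost hsite c π)))
  · rw [planCost, lintegral_finsetSum_measure]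
    push_cast
    refine Finset.sum_congr rfl fun i _ => ?_
    rw [lintegral_prod _ hc.coe_nnreal_ennreal.aemeasurable,
      lintegral_dirac, lintegral_pointMasses]
  · rw [← ENNReal.coe_inj, ← hπ.sum_singleton_fst hsite i]
    push_cast
    simp
  · rw [← ENNReal.coe_inj, ← hπ.sum_singleton_snd hsite j]
    push_cast
    simp
  · push_cast
    simp

end Transfer

/-! ### Existence of warehouse strategies -/

theorem exists_finite_cover {X : Type*} [MetricSpace X] {K : Set X} (hK : IsCompact K) {δ : ℝ}
    (hδ : 0 < δ) : ∃ (n : ℕ) (site : Fin n → X), Function.Injective site ∧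
      K ⊆ ⋃ i, Metric.ball (site i) δ := by
  obtain ⟨t, -, ht⟩ := hK.elim_nhds_subcover (fun x => Metric.ball x δ)
    fun x _ => Metric.ball_mem_nhds x hδ
  refine ⟨t.card, fun i => t.equivFin.symm i,
    Subtype.val_injective.comp t.equivFin.symm.injective, fun x hx => ?_⟩
  obtain ⟨y, hy, hxy⟩ := mem_iUnion₂.1 (ht hx)
  exact mem_iUnion.2 ⟨t.equivFin ⟨y, hy⟩, by simpa using hxy⟩

theorem nonempty_warehouseStrategy_of_isEmpty {X : Type*} [MetricSpace X] [MeasurableSpace X]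
    [IsEmpty X] (c : X × X → ℝ≥0) (lam rho : Measure X) [IsFiniteMeasure lam]
    [IsFiniteMeasure rho] (δ : ℝ) : Nonempty (WarehouseStrategy c lam rho δ) := by
  have hsub : Subsingleton (SignedMeasure X) :=
    ⟨fun s t => by ext A; rw [Set.eq_empty_of_isEmpty A]; simp⟩
  have hs : IsSimple (id : Transfunction X X) := ⟨0, Fin.elim0, Fin.elim0, fun _ => hsub.elim _ _⟩
  have hM : IsMarkov (id : Transfunction X X) :=
    .of_linear ⟨fun _ _ => rfl, fun _ _ => rfl⟩ (fun _ h => h) fun _ => rfl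
  have hcorr : ∀ (μ : Measure X) [IsFiniteMeasure μ], Corresponds (id : Transfunction X X) μ 0 :=
    fun μ _ => ⟨inferInstance, fun A B _ _ => by rw [Set.eq_empty_of_isEmpty B]; simp⟩
  exact ⟨⟨0, Fin.elim0, Fin.elim0, Fin.elim0, id, id, id, hs, hM, hs, hM, hs, hM,
    hsub.elim _ _, hsub.elim _ _, hsub.elim _ _, ⟨0, hcorr _, rfl⟩,
    ⟨0, hcorr _, (hcorr _).isPlan hM (hcorr _).apply_eq, fun _ _ => by simp [planCost]⟩,
    ⟨0, hcorr _, rfl⟩⟩⟩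

/-- The sites are the centres of finitely many `δ`-balls that cover both supports. One partition
of unity subordinate to these balls serves for both local steps. -/
theorem nonempty_warehouseStrategy {X : Type*} [MetricSpace X] [SecondCountableTopology X]
    [MeasurableSpace X] [BorelSpace X] {lam rho : Measure X} [IsFiniteMeasure lam]
    [IsFiniteMeasure rho] (hlam : IsCompact lam.support) (hrho : IsCompact rho.support)
    (hmass : lam univ = rho univ) {c : X × X → ℝ≥0} (hc : Continuous c) {δ : ℝ} (hδ : 0 < δ) :
    Nonempty (WarehouseStrategy c lam rho δ) := by
  rcases isEmpty_or_nonempty X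
  · exact nonempty_warehouseStrategy_of_isEmpty c lam rho δ
  let K := lam.support ∪ rho.support
  have hK : IsCompact K := hlam.union hrho
  have hlamK : ∀ᵐ x ∂lam, x ∈ K :=
    Filter.mem_of_superset lam.support_mem_ae subset_union_left
  have hrhoK : ∀ᵐ x ∂rho, x ∈ K :=
    Filter.mem_of_superset rho.support_mem_ae subset_union_right
  obtain ⟨n, site, hsite, hcover⟩ := exists_finite_cover hK hδ
  obtain ⟨f, hf0, hf1, hfn, hfU⟩ :=
    exists_partition hK.isClosed (fun i => Metric.isOpen_ball) hcover
  let part (μ : Measure X) (i : Fin n) : Measure X :=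
    μ.withDensity fun x => ENNReal.ofReal (f (some i) x)
  have hpart : ∀ (μ : Measure X) [IsFiniteMeasure μ] i, IsFiniteMeasure (part μ i) :=
    fun μ _ i => inferInstance
  have hball : ∀ μ i, ∀ᵐ x ∂part μ i, x ∈ Metric.ball (site i) δ := fun μ i =>
    ae_withDensity_mem (hfU i)
  let w (μ : Measure X) (i : Fin n) : ℝ≥0 := (part μ i univ).toNNReal
  have hw : ∀ (μ : Measure X) [IsFiniteMeasure μ] i, part μ i univ = w μ i := fun μ _ i =>
    (ENNReal.coe_toNNReal (measure_ne_top _ _)).symm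
  have hsum : ∀ (μ : Measure X), (∀ᵐ x ∂μ, x ∈ K) → ∑ i, part μ i = μ :=
    fun μ hμ => sum_withDensity_eq hf0 hf1 hμ hfn
  have hwsum : ∑ i, w lam i = ∑ i, w rho i := by
    rw [← ENNReal.coe_inj]
    push_cast
    simp only [← hw]
    rw [← Measure.finsetSum_apply, ← Measure.finsetSum_apply, hsum lam hlamK, hsum rho hrhoK, hmass]
  have hfar : MeasurableSet {z : X × X | δ < dist z.1 z.2} :=
    measurableSet_lt measurable_const (measurable_fst.dist measurable_snd)
  -- Collection sends the part `f i • lam` to the site `i`; the site that is chosen for the weight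
  -- `f none` does not matter, since this weight vanishes on the support of `lam`.
  let N : Option (Fin n) → Measure X := fun o =>
    Measure.dirac (o.elim (Classical.arbitrary X) site)
  have hcorr := mixture_corresponds (ν := N) hf0 lam
  have := hcorr.finite
  rw [Fintype.sum_option, withDensity_eq_zero_of_ae hlamK hfn, Measure.zero_prod, zero_add] at hcorr
  have hcollect : mixture f N lam.toSignedMeasure =
      (pointMasses site (w lam)).toSignedMeasure := by
    rw [hcorr.apply_eq]
    refine Measure.toSignedMeasure_congr (Measure.ext fun B hB => ?_)
    rw [Measure.snd_apply hB, ← univ_prod, Measure.finsetSum_apply, pointMasses_apply _ _ _ hB]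
    refine Finset.sum_congr rfl fun i _ => ?_
    rw [Measure.prod_prod, ← hw]
    simp [N, part, hB]
  have hcollect_local : IsLocalOn δ (mixture f N) lam := by
    refine ⟨_, hcorr, ?_⟩
    rw [Measure.finsetSum_apply]
    refine Finset.sum_eq_zero fun i _ => ?_
    rw [Measure.measure_prod_null hfar]
    filter_upwards [hball lam i] with x hx
    simp only [N, Option.elim, Pi.zero_apply]
    rw [Measure.dirac_apply' _ (measurable_prodMk_left hfar)]
    simpa using (Metric.mem_ball.1 hx).le
  obtain ⟨T, hTs, hTM, hTapp, hTopt⟩ := exists_optimal_transfer hsite hwsum hc.measurable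
  -- Redistribution replaces the mass at the site `i` by the part `f i • rho`.
  obtain ⟨D, hDs, hDM, hDcorr, hDapp⟩ :=
    exists_simple_markov_of_pointMasses hsite (w := w rho) (m := part rho) (hw rho)
  rw [Measure.toSignedMeasure_congr (hsum rho hrhoK)] at hDapp
  refine ⟨⟨n, site, w lam, w rho, mixture f N, T, D, mixture_isSimple f N,
    mixture_isMarkov hf0 hf1, hTs, hTM, hDs, hDM, hcollect, hTapp, hDapp, hcollect_local, hTopt,
    _, hDcorr, ?_⟩⟩
  rw [Measure.finsetSum_apply]
  refine Finset.sum_eq_zero fun i _ => ?_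
  rw [Measure.dirac_prod, Measure.map_apply measurable_prodMk_left hfar]
  have : ∀ᵐ y ∂part rho i, ¬ δ < dist (site i) y := (hball rho i).mono fun y hy => by
    simpa [dist_comm] using (Metric.mem_ball.1 hy).le
  simpa using ae_iff.1 this

/-! ### Cost estimates for local displacements -/

section Local

variable {X : Type*} [MetricSpace X] [MeasurableSpace X]

theorem transfunctionCost_le_of_isLocalOn {c : X × X → ℝ≥0} {α p : ℝ} (hα : 0 < α) (hp : 0 < p)
    (hcb : ∀ x y, (c (x, y) : ℝ) ≤ α * dist x y ^ p) {δ : ℝ} {Φ : Transfunction X X}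
    (hΦ : IsMarkov Φ) {μ : Measure X} [IsFiniteMeasure μ] (hloc : IsLocalOn δ Φ μ) :
    transfunctionCost c Φ μ ≤ ENNReal.ofReal (α * δ ^ p) * μ univ := by
  obtain ⟨κ, hκ, hnull⟩ := hloc
  have := hκ.finite
  have huniv : κ univ = μ univ := by
    rw [← univ_prod_univ, (hκ.isPlan hΦ hκ.apply_eq).1 _ MeasurableSet.univ]
  rw [hκ.transfunctionCost_eq, ← huniv, planCost, ← lintegral_const]
  refine lintegral_mono_ae ?_
  have : ∀ᵐ z ∂κ, ¬ δ < dist z.1 z.2 := by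
    rw [ae_iff]; simpa using hnull
  filter_upwards [this] with z hz
  rw [← ENNReal.ofReal_coe_nnreal]
  refine ENNReal.ofReal_le_ofReal ((hcb z.1 z.2).trans ?_)
  exact mul_le_mul_of_nonneg_left
    (Real.rpow_le_rpow dist_nonneg (not_lt.1 hz) hp.le) hα.le

theorem IsLocalOn.ae_dist_le {δ : ℝ} {Φ : Transfunction X X} {μ : Measure X}
    [IsFiniteMeasure μ] (h : IsLocalOn δ Φ μ) {K : Kernel X X} [IsMarkovKernel K]
    (hK : IsRepresentedBy Φ K) : ∀ᵐ z ∂(μ ⊗ₘ K), dist z.1 z.2 ≤ δ := by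
  obtain ⟨κ, hκ, hnull⟩ := h
  rw [← hκ.unique (hK.corresponds μ), ae_iff]
  simpa using hnull

end Local

/-- Transport along `K₁`, `K₂`, `K₃` costs at most `η` per unit of mass more than transport along
`K₂` alone, if the displacements by `K₁` and `K₃` change the cost function by at most `η`. -/
theorem lintegral_comp_le {X : Type*} [MeasurableSpace X] {c : X × X → ℝ≥0} (hc : Measurable c)
    {η : ℝ≥0} {μ ν : Measure X} [IsFiniteMeasure μ] {K₁ K₂ K₃ : Kernel X X} [IsMarkovKernel K₁]
    [IsMarkovKernel K₂] [IsMarkovKernel K₃] (hν : K₂ ∘ₘ K₁ ∘ₘ μ = ν) {P Q : X → X → Prop}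
    (h₁ : ∀ᵐ z ∂(μ ⊗ₘ K₁), P z.1 z.2) (h₃ : ∀ᵐ z ∂(ν ⊗ₘ K₃), Q z.1 z.2)
    (hPQ : ∀ x z z' y, P x z → Q z' y → c (x, y) ≤ c (z, z') + η) :
    planCost c (μ ⊗ₘ (K₃ ∘ₖ K₂ ∘ₖ K₁)) ≤ planCost c ((K₁ ∘ₘ μ) ⊗ₘ K₂) + η * μ univ := by
  have hc' : Measurable fun z => (c z : ℝ≥0∞) := hc.coe_nnreal_ennreal
  have hmk : ∀ x, Measurable fun y => (c (x, y) : ℝ≥0∞) := fun x => hc'.comp measurable_prodMk_left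
  have h₃' : ∀ᵐ x ∂μ, ∀ᵐ z ∂K₁ x, ∀ᵐ z' ∂K₂ z, ∀ᵐ y ∂K₃ z', Q z' y := by
    subst hν
    exact Measure.ae_ae_of_ae_comp (Measure.ae_ae_of_ae_comp (Measure.ae_ae_of_ae_compProd h₃))
  have hle : ∀ᵐ x ∂μ, ∫⁻ z, ∫⁻ z', ∫⁻ y, c (x, y) ∂K₃ z' ∂K₂ z ∂K₁ x ≤
      ∫⁻ z, ∫⁻ z', c (z, z') ∂K₂ z ∂K₁ x + η := by
    filter_upwards [Measure.ae_ae_of_ae_compProd h₁, h₃'] with x hx₁ hx₃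
    calc ∫⁻ z, ∫⁻ z', ∫⁻ y, c (x, y) ∂K₃ z' ∂K₂ z ∂K₁ x
        ≤ ∫⁻ z, (∫⁻ z', c (z, z') ∂K₂ z + η) ∂K₁ x := by
          refine lintegral_mono_ae ?_
          filter_upwards [hx₁, hx₃] with z hz₁ hz₃
          calc ∫⁻ z', ∫⁻ y, c (x, y) ∂K₃ z' ∂K₂ z
              ≤ ∫⁻ z', (c (z, z') + η : ℝ≥0∞) ∂K₂ z := by
                refine lintegral_mono_ae ?_
                filter_upwards [hz₃] with z' hz'
                calc ∫⁻ y, c (x, y) ∂K₃ z' ≤ ∫⁻ _, (c (z, z') + η : ℝ≥0∞) ∂K₃ z' :=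
                      lintegral_mono_ae (hz'.mono fun y hy => by
                        exact_mod_cast hPQ x z z' y hz₁ hy)
                  _ = c (z, z') + η := by simp
            _ = ∫⁻ z', c (z, z') ∂K₂ z + η := by
                rw [lintegral_add_left (hmk z)]; simp
      _ = ∫⁻ z, ∫⁻ z', c (z, z') ∂K₂ z ∂K₁ x + η := by
          rw [lintegral_add_right _ measurable_const]; simp
  rw [planCost, planCost, Measure.lintegral_compProd hc', Measure.lintegral_compProd hc',
    Measure.lintegral_bind K₁.aemeasurable (hc'.lintegral_kernel_prod_right').aemeasurable]
  calc ∫⁻ x, ∫⁻ y, c (x, y) ∂(K₃ ∘ₖ K₂ ∘ₖ K₁) x ∂μ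
      = ∫⁻ x, ∫⁻ z, ∫⁻ z', ∫⁻ y, c (x, y) ∂K₃ z' ∂K₂ z ∂K₁ x ∂μ := by
        refine lintegral_congr fun x => ?_
        rw [Kernel.lintegral_comp _ _ _ (hmk x)]
        refine lintegral_congr fun z => ?_
        rw [Kernel.lintegral_comp _ _ _ (hmk x)]
    _ ≤ ∫⁻ x, (∫⁻ z, ∫⁻ z', c (z, z') ∂K₂ z ∂K₁ x + η) ∂μ := lintegral_mono_ae hle
    _ = _ := by rw [lintegral_add_right _ measurable_const, lintegral_const]

/-- Moving the first marginal of a plan by `K` and the second one by `L` raises the cost by at most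
`η` per unit of mass, if these displacements change the cost function by at most `η`. -/
theorem exists_isPlan_planCost_le {X : Type*} [MeasurableSpace X] {c : X × X → ℝ≥0}
    (hc : Measurable c) {η : ℝ≥0} {μ ν : Measure X} [IsFiniteMeasure μ] [IsFiniteMeasure ν]
    {K L : Kernel X X} [IsMarkovKernel K] [IsMarkovKernel L] {P Q : X → X → Prop}
    (h₁ : ∀ᵐ z ∂(μ ⊗ₘ K), P z.1 z.2) (h₂ : ∀ᵐ z ∂(ν ⊗ₘ L), Q z.1 z.2)
    (hPQ : ∀ x z z' y, P x z → Q y z' → c (z, z') ≤ c (x, y) + η)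
    {π : Measure (X × X)} (hπ : IsPlan μ ν π) :
    ∃ π' : Measure (X × X), IsPlan (K ∘ₘ μ) (L ∘ₘ ν) π' ∧
      planCost c π' ≤ planCost c π + η * μ univ := by
  have := hπ.isFiniteMeasure
  have hc' : Measurable fun z => (c z : ℝ≥0∞) := hc.coe_nnreal_ennreal
  refine ⟨(K ∥ₖ L) ∘ₘ π, ⟨fun A hA => ?_, fun B hB => ?_⟩, ?_⟩
  · rw [Measure.bind_apply (hA.prod MeasurableSet.univ) (Kernel.aemeasurable _),
      Measure.bind_apply hA K.aemeasurable, ← hπ.map_fst,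
      lintegral_map (K.measurable_coe hA) measurable_fst]
    simp [Kernel.parallelComp_apply]
  · rw [Measure.bind_apply (MeasurableSet.univ.prod hB) (Kernel.aemeasurable _),
      Measure.bind_apply hB L.aemeasurable, ← hπ.map_snd,
      lintegral_map (L.measurable_coe hB) measurable_snd]
    simp [Kernel.parallelComp_apply]
  · have h₁' : ∀ᵐ w ∂π, ∀ᵐ z ∂K w.1, P w.1 z := by
      have := Measure.ae_ae_of_ae_compProd h₁
      rw [← hπ.map_fst] at this
      exact ae_of_ae_map measurable_fst.aemeasurable this
    have h₂' : ∀ᵐ w ∂π, ∀ᵐ z ∂L w.2, Q w.2 z := by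
      have := Measure.ae_ae_of_ae_compProd h₂
      rw [← hπ.map_snd] at this
      exact ae_of_ae_map measurable_snd.aemeasurable this
    have huniv : π univ = μ univ := by rw [← univ_prod_univ, hπ.1 _ MeasurableSet.univ]
    rw [planCost, Measure.lintegral_bind (Kernel.aemeasurable _) hc'.aemeasurable, ← huniv]
    calc ∫⁻ w, ∫⁻ z, c z ∂(K ∥ₖ L) w ∂π ≤ ∫⁻ w, (c w + η : ℝ≥0∞) ∂π := by
          refine lintegral_mono_ae ?_
          filter_upwards [h₁', h₂'] with w hw₁ hw₂
          rw [Kernel.parallelComp_apply, lintegral_prod _ hc'.aemeasurable]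
          calc ∫⁻ z, ∫⁻ z', c (z, z') ∂L w.2 ∂K w.1
              ≤ ∫⁻ _, ∫⁻ _, (c w + η : ℝ≥0∞) ∂L w.2 ∂K w.1 :=
                lintegral_mono_ae (hw₁.mono fun z hz => lintegral_mono_ae (hw₂.mono fun z' hz' => by
                  exact_mod_cast hPQ w.1 z z' w.2 hz hz'))
            _ = c w + η := by simp
      _ = planCost c π + η * π univ := by
          rw [lintegral_add_left hc', lintegral_const, planCost]

/-! ### Costs of a warehouse strategy -/

theorem transfunctionCost_of_isEmpty {X Y : Type*} [MeasurableSpace X] [MeasurableSpace Y]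
    [IsEmpty X] [IsEmpty Y] (c : X × Y → ℝ≥0) (Φ : Transfunction X Y) (μ : Measure X)
    [IsFiniteMeasure μ] : transfunctionCost c Φ μ = 0 := by
  have h : Corresponds Φ μ 0 :=
    ⟨inferInstance, fun A B _ _ => by rw [Set.eq_empty_of_isEmpty B]; simp⟩
  rw [h.transfunctionCost_eq]
  simp [planCost]

namespace WarehouseStrategy

variable {X : Type*} [MetricSpace X] [MeasurableSpace X] {c : X × X → ℝ≥0} {lam rho : Measure X}
  [IsFiniteMeasure lam] [IsFiniteMeasure rho] {δ : ℝ} (W : WarehouseStrategy c lam rho δ)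

theorem total_isMarkov : IsMarkov W.total :=
  W.distribute_markov.comp (W.transfer_markov.comp W.collect_markov)

theorem total_isSimple : IsSimple W.total :=
  .comp W.distribute_markov.stronglySigmaAdditive.linear
    (.comp W.transfer_markov.stronglySigmaAdditive.linear W.collect_simple)

theorem total_apply : W.total lam.toSignedMeasure = rho.toSignedMeasure := by
  simp only [total, Function.comp, W.collect_apply, W.transfer_apply, W.distribute_apply]

theorem collectCost_le {α p : ℝ} (hα : 0 < α) (hp : 0 < p)
    (hcb : ∀ x y, (c (x, y) : ℝ) ≤ α * dist x y ^ p) :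
    W.collectCost ≤ ENNReal.ofReal (α * δ ^ p) * lam univ :=
  transfunctionCost_le_of_isLocalOn hα hp hcb W.collect_markov W.collect_local

theorem distributeCost_le {α p : ℝ} (hα : 0 < α) (hp : 0 < p)
    (hcb : ∀ x y, (c (x, y) : ℝ) ≤ α * dist x y ^ p) :
    W.distributeCost ≤ ENNReal.ofReal (α * δ ^ p) * lam univ := by
  rw [← W.collect_markov.measure_univ_eq W.collect_apply,
    ← W.transfer_markov.measure_univ_eq W.transfer_apply]
  exact transfunctionCost_le_of_isLocalOn hα hp hcb W.distribute_markov W.distribute_local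

variable [CompleteSpace X] [SecondCountableTopology X] [BorelSpace X]

/-- If displacements by at most `δ` at both ends of a path between the supports change its cost by
at most `η`, then the total cost, the cost of the transfer and the optimal cost are close to each
other. For the second inequality, the transfer is compared with an arbitrary plan between `lam` and
`rho` by collecting the first marginal of this plan and moving the second one backwards, along the
disintegration of the redistribution plan over its target. -/
theorem transferCost_estimates (hc : Measurable c) {η : ℝ≥0}
    (hη : ∀ x ∈ lam.support, ∀ y ∈ rho.support, ∀ z z', dist x z ≤ δ → dist z' y ≤ δ →
      c (x, y) ≤ c (z, z') + η ∧ c (z, z') ≤ c (x, y) + η) :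
    transfunctionCost c W.total lam ≤ W.transferCost + η * lam univ ∧
      W.transferCost ≤ optimalCost c lam rho + η * lam univ := by
  -- The posterior kernel used below exists on nonempty spaces only.
  rcases isEmpty_or_nonempty X
  · simp [transferCost, transfunctionCost_of_isEmpty]
  obtain ⟨K₁, _, hK₁⟩ := exists_isRepresentedBy W.collect_simple W.collect_markov
  obtain ⟨K₂, _, hK₂⟩ := exists_isRepresentedBy W.transfer_simple W.transfer_markov
  obtain ⟨K₃, _, hK₃⟩ := exists_isRepresentedBy W.distribute_simple W.distribute_markov
  have e₁ := hK₁.bind_eq W.collect_apply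
  have e₂ := hK₂.bind_eq W.transfer_apply
  have e₃ := hK₃.bind_eq W.distribute_apply
  have hd₁ : ∀ᵐ z ∂(lam ⊗ₘ K₁), z.1 ∈ lam.support ∧ dist z.1 z.2 ≤ δ := by
    have : ∀ᵐ z ∂(lam ⊗ₘ K₁), z.1 ∈ lam.support := by
      refine ae_of_ae_map measurable_fst.aemeasurable (p := fun x => x ∈ lam.support) ?_
      rw [← Measure.fst, Measure.fst_compProd]
      exact lam.support_mem_ae
    filter_upwards [this, W.collect_local.ae_dist_le hK₁] with z h h' using ⟨h, h'⟩
  have hd₃ : ∀ᵐ z ∂(pointMasses W.site W.demand ⊗ₘ K₃),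
      z.2 ∈ rho.support ∧ dist z.1 z.2 ≤ δ := by
    have : ∀ᵐ z ∂(pointMasses W.site W.demand ⊗ₘ K₃), z.2 ∈ rho.support := by
      refine ae_of_ae_map measurable_snd.aemeasurable (p := fun x => x ∈ rho.support) ?_
      rw [← Measure.snd, Measure.snd_compProd, e₃]
      exact rho.support_mem_ae
    filter_upwards [this, W.distribute_local.ae_dist_le hK₃] with z h h' using ⟨h, h'⟩
  have htransfer : W.transferCost = planCost c (pointMasses W.site W.stock ⊗ₘ K₂) :=
    (hK₂.corresponds _).transfunctionCost_eq c
  constructor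
  · have hrep : IsRepresentedBy W.total (K₃ ∘ₖ (K₂ ∘ₖ K₁)) := hK₃.comp (hK₂.comp hK₁)
    rw [(hrep.corresponds lam).transfunctionCost_eq c, htransfer, ← e₁, ← Kernel.comp_assoc]
    refine lintegral_comp_le hc (ν := pointMasses W.site W.demand) (by rw [e₁, e₂])
      (P := fun x z => x ∈ lam.support ∧ dist x z ≤ δ)
      (Q := fun z' y => y ∈ rho.support ∧ dist z' y ≤ δ) hd₁ hd₃ ?_
    exact fun x z z' y h h' => (hη x h.1 y h'.1 z z' h.2 h'.2).1
  · -- The posterior of `K₃` is the kernel that moves `rho` back to the sites.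
    obtain ⟨κ, hκ, hopt⟩ := W.transfer_optimal
    have := hκ.finite
    have hsnd : κ.snd = pointMasses W.site W.demand :=
      (Measure.toSignedMeasure_eq_toSignedMeasure_iff).1 (hκ.apply_eq.symm.trans W.transfer_apply)
    rw [hsnd] at hopt
    rw [← tsub_le_iff_right, optimalCost]
    refine le_iInf₂ fun π hπ => ?_
    rw [tsub_le_iff_right]
    have hd₃' : ∀ᵐ z ∂(rho ⊗ₘ posterior K₃ (pointMasses W.site W.demand)),
        z.1 ∈ rho.support ∧ dist z.2 z.1 ≤ δ := by
      have := compProd_posterior_eq_map_swap (κ := K₃) (μ := pointMasses W.site W.demand)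
      rw [e₃] at this
      rw [this]
      exact (MeasurableEquiv.prodComm.measurableEmbedding.ae_map_iff).2 hd₃
    obtain ⟨π', hπ', hle⟩ := exists_isPlan_planCost_le hc (η := η)
      (P := fun x z => x ∈ lam.support ∧ dist x z ≤ δ)
      (Q := fun y z' => y ∈ rho.support ∧ dist z' y ≤ δ) hd₁ hd₃'
      (fun x z z' y h h' => (hη x h.1 y h'.1 z z' h.2 h'.2).2) hπ
    have e₃' : posterior K₃ (pointMasses W.site W.demand) ∘ₘ rho = pointMasses W.site W.demand := by
      have := posterior_comp_self (κ := K₃) (μ := pointMasses W.site W.demand)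
      rwa [e₃] at this
    rw [e₁, e₃'] at hπ'
    rw [transferCost, hκ.transfunctionCost_eq]
    exact (hopt.2 π' hπ').trans hle

end WarehouseStrategy

/-- The product plan has finite cost, because `c` is bounded on the compact product of the
supports. -/
theorem optimalCost_ne_top {X : Type*} [MetricSpace X] [SecondCountableTopology X]
    [MeasurableSpace X] [BorelSpace X] {lam rho : Measure X} [IsFiniteMeasure lam]
    [IsFiniteMeasure rho] (hlam : IsCompact lam.support) (hrho : IsCompact rho.support)
    (hmass : lam univ = rho univ) {c : X × X → ℝ≥0} (hc : Continuous c) :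
    optimalCost c lam rho ≠ ∞ := by
  by_cases h0 : lam univ = 0
  · have : IsPlan lam rho 0 := by
      rw [Measure.measure_univ_eq_zero.1 h0, Measure.measure_univ_eq_zero.1 (hmass.symm.trans h0)]
      exact ⟨fun _ _ => rfl, fun _ _ => rfl⟩
    refine ne_top_of_le_ne_top ?_ (iInf₂_le 0 this)
    simp [planCost]
  have hfin : lam univ ≠ ∞ := measure_ne_top _ _
  have hplan : IsPlan lam rho ((lam univ)⁻¹ • lam.prod rho) := by
    constructor
    · intro A _
      rw [Measure.smul_apply, Measure.prod_prod, ← hmass, smul_eq_mul, mul_comm (lam A),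
        ← mul_assoc, ENNReal.inv_mul_cancel h0 hfin, one_mul]
    · intro B _
      rw [Measure.smul_apply, Measure.prod_prod, smul_eq_mul,
        ← mul_assoc, ENNReal.inv_mul_cancel h0 hfin, one_mul]
  obtain ⟨M, hM⟩ := (hlam.prod hrho).bddAbove_image hc.continuousOn
  refine ne_top_of_le_ne_top ?_ (iInf₂_le _ hplan)
  rw [planCost, lintegral_smul_measure]
  refine ENNReal.mul_ne_top (ENNReal.inv_ne_top.2 h0) ?_
  have hae : ∀ᵐ z ∂lam.prod rho, (c z : ℝ≥0∞) ≤ M := by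
    have h₁ : ∀ᵐ z ∂lam.prod rho, z.1 ∈ lam.support :=
      Measure.quasiMeasurePreserving_fst.ae lam.support_mem_ae
    have h₂ : ∀ᵐ z ∂lam.prod rho, z.2 ∈ rho.support :=
      Measure.quasiMeasurePreserving_snd.ae rho.support_mem_ae
    filter_upwards [h₁, h₂] with z hz₁ hz₂
    exact_mod_cast hM (mem_image_of_mem c (⟨hz₁, hz₂⟩ : z ∈ lam.support ×ˢ rho.support))
  refine ne_top_of_le_ne_top ?_ (lintegral_mono_ae hae)
  rw [lintegral_const]
  exact ENNReal.mul_ne_top ENNReal.coe_ne_top (measure_ne_top _ _)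

/-- The moved points `z`, `z'` need not lie in the compact sets, so that no compact neighbourhood of
the supports is required. -/
theorem exists_modulus {X : Type*} [MetricSpace X] {K L : Set X} (hK : IsCompact K)
    (hL : IsCompact L) {c : X × X → ℝ≥0} (hc : Continuous c) {η : ℝ≥0} (hη : 0 < η) :
    ∃ δ₀ : ℝ, 0 < δ₀ ∧ ∀ δ ≤ δ₀, ∀ x ∈ K, ∀ y ∈ L, ∀ z z', dist x z ≤ δ → dist z' y ≤ δ →
      c (x, y) ≤ c (z, z') + η ∧ c (z, z') ≤ c (x, y) + η := by
  have h := (hK.prod hL).uniformContinuousAt_of_continuousAt c (fun z _ => hc.continuousAt)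
    (Metric.dist_mem_uniformity (NNReal.coe_pos.2 hη))
  obtain ⟨δ₀, hδ₀, h⟩ := Metric.mem_uniformity_dist.1 h
  refine ⟨δ₀ / 2, half_pos hδ₀, fun δ hδ x hx y hy z z' hz hz' => ?_⟩
  have hlt : dist (x, y) (z, z') < δ₀ := by
    rw [Prod.dist_eq]
    rw [dist_comm] at hz'
    exact max_lt (by linarith) (by linarith)
  have := h hlt ⟨hx, hy⟩
  simp only [mem_ofPred_eq, NNReal.dist_eq] at this
  obtain ⟨h₁, h₂⟩ := abs_lt.1 this
  constructor <;> rw [← NNReal.coe_le_coe, NNReal.coe_add] <;> linarith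

end Transport

/-! ### Approximation of the optimal cost -/

theorem mainTheorem6 {X : Type*} [MetricSpace X] [CompleteSpace X] [SecondCountableTopology X]
    [LocallyCompactSpace X] [MeasurableSpace X] [BorelSpace X]
    (lam rho : Measure X) [IsFiniteMeasure lam] [IsFiniteMeasure rho]
    (hlam : IsCompact lam.support) (hrho : IsCompact rho.support)
    (hmass : lam univ = rho univ)
    (c : X × X → ℝ≥0) (hc : Continuous c) (α p : ℝ) (hα : 0 < α) (hp : 0 < p)
    (hcb : ∀ x y, (c (x, y) : ℝ) ≤ α * dist x y ^ p) :
    Transport.optimalCost c lam rho ≠ ∞ ∧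
    -- the optimal cost is approximated by costs of simple Markov transfunctions
    (∀ ε : ℝ≥0, 0 < ε → ∃ Φ : Transport.Transfunction X X,
      Transport.IsSimple Φ ∧ Transport.IsMarkov Φ ∧
      Φ lam.toSignedMeasure = rho.toSignedMeasure ∧
      Transport.optimalCost c lam rho ≤ Transport.transfunctionCost c Φ lam ∧
      Transport.transfunctionCost c Φ lam ≤ Transport.optimalCost c lam rho + ε) ∧
    -- warehouse strategies exist at every scale
    (∀ δ : ℝ, 0 < δ → Nonempty (Transport.WarehouseStrategy c lam rho δ)) ∧
    -- their two local steps cost at most `α δ ^ p ‖lam‖` each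
    (∀ δ : ℝ, 0 < δ → ∀ W : Transport.WarehouseStrategy c lam rho δ,
      W.collectCost ≤ ENNReal.ofReal (α * δ ^ p) * lam univ ∧
      W.distributeCost ≤ ENNReal.ofReal (α * δ ^ p) * lam univ) ∧
    -- their costs approach the optimal cost as the scale decreases to zero
    (∀ ε : ℝ≥0, 0 < ε → ∃ δ₀ : ℝ, 0 < δ₀ ∧ ∀ δ : ℝ, 0 < δ → δ ≤ δ₀ →
      ∀ W : Transport.WarehouseStrategy c lam rho δ,
        (Transport.IsSimple W.total ∧ Transport.IsMarkov W.total ∧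
          W.total lam.toSignedMeasure = rho.toSignedMeasure) ∧
        (Transport.optimalCost c lam rho ≤ Transport.transfunctionCost c W.total lam ∧
          Transport.transfunctionCost c W.total lam ≤ Transport.optimalCost c lam rho + ε) ∧
        (Transport.optimalCost c lam rho ≤ W.transferCost + ε ∧
          W.transferCost ≤ Transport.optimalCost c lam rho + ε) ∧
        (Transport.optimalCost c lam rho ≤
            W.collectCost + W.transferCost + W.distributeCost + ε ∧
          W.collectCost + W.transferCost + W.distributeCost ≤
            Transport.optimalCost c lam rho + ε)) := by
  have costs_close : ∀ ε : ℝ≥0, 0 < ε → ∃ δ₀ : ℝ, 0 < δ₀ ∧ ∀ δ : ℝ, 0 < δ → δ ≤ δ₀ →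
      ∀ W : Transport.WarehouseStrategy c lam rho δ,
        (Transport.IsSimple W.total ∧ Transport.IsMarkov W.total ∧
          W.total lam.toSignedMeasure = rho.toSignedMeasure) ∧
        (Transport.optimalCost c lam rho ≤ Transport.transfunctionCost c W.total lam ∧
          Transport.transfunctionCost c W.total lam ≤ Transport.optimalCost c lam rho + ε) ∧
        (Transport.optimalCost c lam rho ≤ W.transferCost + ε ∧
          W.transferCost ≤ Transport.optimalCost c lam rho + ε) ∧
        (Transport.optimalCost c lam rho ≤
            W.collectCost + W.transferCost + W.distributeCost + ε ∧
          W.collectCost + W.transferCost + W.distributeCost ≤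
            Transport.optimalCost c lam rho + ε) := by
    intro ε hε
    let m : ℝ≥0 := (lam univ).toNNReal
    have hm : lam univ = m := (ENNReal.coe_toNNReal (measure_ne_top _ _)).symm
    -- Three errors of size at most `η * m` occur in the last estimate.
    let η : ℝ≥0 := ε / (3 * (m + 1))
    have hη : 0 < η := by positivity
    have hηm : 3 * (η * lam univ) ≤ ε := by
      rw [hm]
      have : 3 * (η * m) ≤ ε :=
        calc 3 * (η * m) ≤ 3 * (η * (m + 1)) := by gcongr; exact le_self_add
          _ = ε := by simp only [η]; field_simp
      exact_mod_cast this
    obtain ⟨δ₁, hδ₁, hmod⟩ := Transport.exists_modulus hlam hrho hc hη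
    -- At the scale `δ₂` the bound `α * δ₂ ^ p` of the local costs per unit of mass is `η`.
    let δ₂ : ℝ := (η / α) ^ p⁻¹
    have hδ₂ : 0 < δ₂ := by have : (0 : ℝ) < η := hη; positivity
    refine ⟨min δ₁ δ₂, lt_min hδ₁ hδ₂, fun δ hδ hδle W => ?_⟩
    have hloc : ENNReal.ofReal (α * δ ^ p) * lam univ ≤ η * lam univ := by
      gcongr
      rw [← ENNReal.ofReal_coe_nnreal]
      refine ENNReal.ofReal_le_ofReal ?_
      calc α * δ ^ p ≤ α * δ₂ ^ p := by gcongr; exact hδle.trans (min_le_right _ _)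
        _ = η := by
          rw [Real.rpow_inv_rpow (by positivity) hp.ne', mul_div_cancel₀ _ hα.ne']
    have h₁ := (W.collectCost_le hα hp hcb).trans hloc
    have h₃ := (W.distributeCost_le hα hp hcb).trans hloc
    obtain ⟨h₂, h₂'⟩ := W.transferCost_estimates hc.measurable
      (hmod δ (hδle.trans (min_le_left _ _)))
    have h := Transport.optimalCost_le_transfunctionCost W.total_isMarkov W.total_apply c
    generalize η * lam univ = r at hηm h₁ h₂ h₂' h₃
    have hr : r + r + r ≤ ε := by convert hηm using 1; ring
    have hr₂ : r + r ≤ ε := le_self_add.trans hr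
    have hr₁ : r ≤ ε := le_self_add.trans hr₂
    have hlower : Transport.optimalCost c lam rho ≤ W.transferCost + ε := by
      grw [h, h₂, hr₁]
    refine ⟨⟨W.total_isSimple, W.total_isMarkov, W.total_apply⟩, ⟨h, ?_⟩, ⟨hlower, ?_⟩, ?_, ?_⟩
    · grw [h₂, h₂', add_assoc, hr₂]
    · grw [h₂', hr₁]
    · refine hlower.trans (add_le_add_left ?_ _)
      exact le_add_self.trans le_self_add
    · calc W.collectCost + W.transferCost + W.distributeCost
          ≤ r + (Transport.optimalCost c lam rho + r) + r := by gcongr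
        _ = Transport.optimalCost c lam rho + (r + r + r) := by ring
        _ ≤ Transport.optimalCost c lam rho + ε := by gcongr
  have hexists : ∀ δ : ℝ, 0 < δ → Nonempty (Transport.WarehouseStrategy c lam rho δ) :=
    fun δ hδ => Transport.nonempty_warehouseStrategy hlam hrho hmass hc hδ
  refine ⟨Transport.optimalCost_ne_top hlam hrho hmass hc, fun ε hε => ?_, hexists,
    fun δ _ W => ⟨W.collectCost_le hα hp hcb, W.distributeCost_le hα hp hcb⟩, costs_close⟩
  obtain ⟨δ, hδ, h⟩ := costs_close ε hε
  obtain ⟨W⟩ := hexists δ hδ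
  obtain ⟨⟨hs, hM, happly⟩, ⟨hle, hle'⟩, -⟩ := h δ hδ le_rfl W
  exact ⟨W.total, hs, hM, happly, hle, hle'⟩
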